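/- Let $f,g\in\mathbb{C}[x]$, $m=\deg f$, $n=\deg g$, with $m<n<2m+1$, and let $f_0,g_0\neq 0$ be the leading coefficients of $f=f_0x^m+\dots+f_m$ and $g=g_0x^n+\dots+g_n$. Consider the Liénard system $$x_t=y,\qquad y_t=-f(x)y-g(x),$$ with vector field $\mathcal{X}=y\,\partial_x-(f(x)y+g(x))\,\partial_y$. An invariant algebraic curve of the system is a polynomial $F\in\mathbb{C}[x,y]\setminus\mathbb{C}$ such that $\mathcal{X}F=\lambda F$ for some $\lambda\in\mathbb{C}[x,y]$; polynomials that differ by a nonzero constant factor define the same curve. Let $q(x)=\sum_{l=0}^{m}q_l\,x^{m+1-l}$, where $q_0=-\frac{f_0}{m+1}$ and, for $1\le l\le m$, $$q_l=\frac{m+1}{(m+1-l)f_0}\Big\{\sum_{k=0}^{l-1}q_kf_{l-k}+\sum_{k=1}^{l-1}(m+1-k)q_kq_{l-k}+g_{n+l-(2m+1)}\Big\},$$ with $g_{j}=0$ for $j<0$. Then: 1. The system has at most two distinct irreducible invariant algebraic curves. 2. There is exactly one Laurent series $y_{II}(x)=-\frac{g_0}{f_0}x^{n-m}+\sum_{l\ge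 1}a_l x^{n-m-l}$ near $x=\infty$ (the series of type (II)) that satisfies $yy_x+f(x)y+g(x)=0$. If the system has two distinct irreducible invariant algebraic curves, then one of them, $G$, captures this series, that is $G(x,y_{II}(x))=0$, and does so with exponent $k=1$ (the root $y=y_{II}(x)$ of $G$ is simple); the other one is, up to a constant factor, $y-q(x)-z_0$ with $z_0\in\mathbb{C}$, and $z_0$ is the only complex number $z$ for which $y-q(x)-z$ is an invariant algebraic curve of the system. 3. The system has no rational first integral: there is no non-constant rational function $R\in\mathbb{C}(x,y)$ with $\mathcal{X}R=0$. -/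

import Mathlib

open Polynomial
open scoped Polynomial.Bivariate

namespace Lienard

noncomputable section

/-! Elements of `ℂ[X][Y]` are the polynomials in two variables over `ℂ`: the inner variable is `x`,
the outer variable is `y`. -/

/-- The partial derivative `∂F/∂x`, which differentiates the coefficients of `F`. (The partial
derivative `∂F/∂y` is `Polynomial.derivative F`.) -/
def partialX (F : ℂ[X][Y]) : ℂ[X][Y] :=
  PolynomialModule.equivPolynomialSelf ((derivative' (R := ℂ)).mapCoeffs F)

/-- The action on polynomials of the vector field `P ∂/∂x + Q ∂/∂y`. -/
def vectorField (P Q F : ℂ[X][Y]) : ℂ[X][Y] :=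
  P * partialX F + Q * derivative F

/-- `F` is an invariant algebraic curve (a Darboux polynomial) of the system
`x_t = P(x,y)`, `y_t = Q(x,y)`: it is not constant and divides its derivative along
the vector field; the quotient is the cofactor. -/
def IsInvariantCurve (P Q F : ℂ[X][Y]) : Prop :=
  (∀ c : ℂ, F ≠ C (C c)) ∧ ∃ cofactor : ℂ[X][Y], vectorField P Q F = cofactor * F

/-- The system `x_t = P(x,y)`, `y_t = Q(x,y)` has a rational first integral: a non-constant rational
function `A / B` whose derivative `(B · 𝒳A - A · 𝒳B) / B²` along the vector field `𝒳` is zero. -/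
def HasRationalFirstIntegral (P Q : ℂ[X][Y]) : Prop :=
  ∃ A B : ℂ[X][Y], B ≠ 0 ∧ (∀ c : ℂ, A ≠ C (C c) * B) ∧
    B * vectorField P Q A - A * vectorField P Q B = 0

/-- The right-hand side `-f(x) y - g(x)` of the second equation of the Liénard system
`x_t = y`, `y_t = -f(x) y - g(x)`. -/
def rhs (f g : ℂ[X]) : ℂ[X][Y] := -(C f * Y) - C g

/-- `F` is an irreducible invariant algebraic curve of the Liénard system
`x_t = y`, `y_t = -f(x) y - g(x)`. -/
def IsIrreducibleCurve (f g : ℂ[X]) (F : ℂ[X][Y]) : Prop :=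
  Irreducible F ∧ IsInvariantCurve Y (rhs f g) F

/-- The set of irreducible invariant algebraic curves of the Liénard system, where polynomials that
differ by a nonzero constant factor are identified. -/
def irreducibleCurves (f g : ℂ[X]) : Set (Associates ℂ[X][Y]) :=
  {c | ∃ F, IsIrreducibleCurve f g F ∧ Associates.mk F = c}

/-! Laurent series near `x = ∞` are Laurent series in the local parameter `t = x⁻¹`: the coefficient
of `x ^ (-k)` in `y` is `y.coeff k`. -/

/-- The expansion at `x = ∞` of a polynomial in `x`, with `x = t⁻¹`. -/
def atInfinity : ℂ[X] →+* LaurentSeries ℂ :=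
  (aeval (HahnSeries.single (-1 : ℤ) (1 : ℂ) : LaurentSeries ℂ)).toRingHom

/-- The derivative `d/dx = -t² d/dt` of a Laurent series near `x = ∞`. -/
def derivX (y : LaurentSeries ℂ) : LaurentSeries ℂ :=
  -(HahnSeries.single (2 : ℤ) (1 : ℂ) * LaurentSeries.derivative ℂ y)

/-- `y` is a series of type (II): a Laurent series near `x = ∞` with leading term
`-(g₀ / f₀) x ^ (n - m)`, where `m = deg f`, `n = deg g` and `f₀`, `g₀` are the leading
coefficients, that solves the equation `y y_x + f(x) y + g(x) = 0`. -/
def IsTypeTwoSeries (f g : ℂ[X]) (y : LaurentSeries ℂ) : Prop :=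
  (∀ k : ℤ, k < (f.natDegree : ℤ) - g.natDegree → y.coeff k = 0) ∧
  y.coeff ((f.natDegree : ℤ) - g.natDegree) = -(g.leadingCoeff / f.leadingCoeff) ∧
  y * derivX y + atInfinity f * y + atInfinity g = 0

/-- The curve `F` captures the series `y`, that is `F(x, y(x)) = 0`. -/
def Captures (F : ℂ[X][Y]) (y : LaurentSeries ℂ) : Prop :=
  F.eval₂ atInfinity y = 0

/-- The exponent of the factor `y - y(x)` in the factorization of `F` over series near `x = ∞`. -/
def captureExponent (F : ℂ[X][Y]) (y : LaurentSeries ℂ) : ℕ :=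
  (F.map atInfinity).rootMultiplicity y

/-- The coefficients `q_l`, `0 ≤ l ≤ m = deg f`, in
`q(x) = q_0 x ^ (m + 1) + q_1 x ^ m + ⋯ + q_m x`: with `f = f_0 x ^ m + ⋯ + f_m`,
`q_0 = -f_0 / (m + 1)` and, for `1 ≤ l ≤ m`,
`q_l = (m + 1) / ((m + 1 - l) f_0) * (∑_{k=0}^{l-1} q_k f_{l-k}
  + ∑_{k=1}^{l-1} (m + 1 - k) q_k q_{l-k} + [coefficient of x ^ (2m + 1 - l) in g])`.
The second clause below gives `q_{l+1}`, and its second sum is re-indexed by `k ↦ k + 1`. -/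
def qCoeff (f g : ℂ[X]) : ℕ → ℂ
  | 0 => -(f.leadingCoeff / ((f.natDegree : ℂ) + 1))
  | l + 1 =>
    ((f.natDegree : ℂ) + 1) / (((f.natDegree : ℂ) - (l : ℂ)) * f.leadingCoeff) *
      ((∑ k : Fin (l + 1), qCoeff f g k.1 * f.coeff (f.natDegree - (l + 1 - k.1))) +
        (∑ k : Fin l,
          ((f.natDegree : ℂ) - (k.1 : ℂ)) * qCoeff f g (k.1 + 1) * qCoeff f g (l - k.1)) +
        g.coeff (2 * f.natDegree - l))
  decreasing_by all_goals omega

/-- The polynomial `q(x)`: the part with positive exponents of the series of type (I), which are the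
series near `x = ∞` with leading term `-(f_0 / (m + 1)) x ^ (m + 1)` that solve
`y y_x + f(x) y + g(x) = 0`. -/
def q (f g : ℂ[X]) : ℂ[X] :=
  ∑ l ∈ Finset.range (f.natDegree + 1), C (qCoeff f g l) * X ^ (f.natDegree + 1 - l)

/-- The polynomial `y - q(x) - z`. -/
def lineCurve (f g : ℂ[X]) (z : ℂ) : ℂ[X][Y] := Y - C (q f g) - C (C z)

end

end Lienard

/-! Write 𝒳 for the vector field. Comparing degrees in y in 𝒳F = λF shows that λ depends on x alone
and that the leading coefficient of F in y is constant (`cofactor_eq_C`). Irreducible curves are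
then sorted by whether they capture the series y_II.

Two irreducible curves that capture y_II share a root in the field of Laurent series, so they are
associated by Gauss's lemma; the root is simple because the characteristic is 0.

If F does not capture y_II, put E = F(x, y_II(x)) ≠ 0. The chain rule gives λE = y_II E_x, and since
d/dx lowers the degree at infinity, λ = 0 or deg λ ≤ n - m - 1 < m. The polynomial q solves y y_x +
f y + g = 0 up to a remainder of degree at most m. With this, a Newton polygon argument on F(x, u +
q(x)) (`natDegree_coeff_eq_zero`) shows that all its coefficients in u are constant. Over ℂ such a
polynomial splits into factors u - z, so F is y - q - z up to a constant. Only one z is possible,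
because g ≠ 0. Hence each of the two classes contains at most one curve.

A rational first integral A/B in lowest terms would give a pencil A - cB of pairwise coprime
polynomials with a common cofactor, hence infinitely many irreducible curves. -/

namespace Lienard

/-! ### The vector field as a derivation -/

@[simp]
theorem coeff_partialX (F : ℂ[X][Y]) (i : ℕ) :
    (partialX F).coeff i = derivative (F.coeff i) := rfl

theorem partialX_add (F G : ℂ[X][Y]) : partialX (F + G) = partialX F + partialX G := by
  ext1 i; simp

theorem partialX_sub (F G : ℂ[X][Y]) : partialX (F - G) = partialX F - partialX G := by
  ext1 i; simp

@[simp]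
theorem partialX_C (p : ℂ[X]) : partialX (C p) = C (derivative p) := by
  ext1 i; rw [coeff_partialX, coeff_C, coeff_C]; split_ifs <;> simp

@[simp]
theorem partialX_Y : partialX Y = 0 := by
  ext1 i; rw [coeff_partialX, coeff_X]; split_ifs <;> simp

theorem partialX_mul (F G : ℂ[X][Y]) : partialX (F * G) = partialX F * G + F * partialX G := by
  ext1 i
  simp only [coeff_partialX, coeff_mul, coeff_add, derivative_sum, derivative_mul,
    Finset.sum_add_distrib]

theorem vectorField_sub (P Q F G : ℂ[X][Y]) :
    vectorField P Q (F - G) = vectorField P Q F - vectorField P Q G := by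
  simp only [vectorField, partialX_sub, derivative_sub]; ring

theorem vectorField_mul (P Q F G : ℂ[X][Y]) :
    vectorField P Q (F * G) = vectorField P Q F * G + F * vectorField P Q G := by
  simp only [vectorField, partialX_mul, derivative_mul]; ring

theorem vectorField_pow (P Q F : ℂ[X][Y]) (k : ℕ) :
    vectorField P Q (F ^ (k + 1)) = (k + 1 : ℂ[X][Y]) * F ^ k * vectorField P Q F := by
  induction k with
  | zero => simp
  | succ k ih => rw [pow_succ, vectorField_mul, ih]; push_cast; ring

@[simp]
theorem vectorField_C_C (P Q : ℂ[X][Y]) (c : ℂ) : vectorField P Q (C (C c)) = 0 := by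
  simp [vectorField]

/-- An irreducible factor of a Darboux polynomial is a Darboux polynomial. -/
theorem dvd_vectorField_of_irreducible_dvd {P Q F p : ℂ[X][Y]} (hF : F ≠ 0)
    (h : F ∣ vectorField P Q F) (hp : Irreducible p) (hpF : p ∣ F) : p ∣ vectorField P Q p := by
  have hpp : Prime p := hp.prime
  obtain ⟨k, G, hG, rfl⟩ : ∃ k G, ¬ p ∣ G ∧ F = p ^ k * G := by
    obtain ⟨G, hFG, hG⟩ :=
      (FiniteMultiplicity.of_prime_left hpp hF).exists_eq_pow_mul_and_not_dvd
    exact ⟨_, G, hG, hFG⟩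
  cases k with
  | zero => simp [hG] at hpF
  | succ k =>
    -- By Leibniz, 𝒳(p^(k+1) G) is this product plus a multiple of p^(k+1). After cancelling p^k, p
    -- must divide 𝒳p, since k + 1 is a unit in characteristic 0 and p does not divide G.
    have h1 : p ^ (k + 1) ∣ p ^ k * ((k + 1 : ℂ[X][Y]) * vectorField P Q p * G) := by
      have h2 := (dvd_mul_right (p ^ (k + 1)) G).trans h
      rw [vectorField_mul, vectorField_pow] at h2
      have h3 := (dvd_add_left (dvd_mul_right (p ^ (k + 1)) (vectorField P Q G))).1 h2
      convert h3 using 1; ring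
    rw [pow_succ, mul_dvd_mul_iff_left (pow_ne_zero _ hp.ne_zero)] at h1
    rcases hpp.dvd_or_dvd h1 with h1 | h1
    · rcases hpp.dvd_or_dvd h1 with h1 | h1
      · exfalso
        refine hp.not_isUnit (isUnit_of_dvd_unit h1 ?_)
        have : ((k : ℂ[X][Y]) + 1) = C (C ((k : ℂ) + 1)) := by simp
        rw [this]
        refine (IsUnit.map C (IsUnit.map C ?_))
        exact isUnit_iff_ne_zero.2 (by exact_mod_cast Nat.succ_ne_zero k)
      · exact h1
    · exact absurd h1 hG

theorem ne_C_C_of_irreducible {p : ℂ[X][Y]} (hp : Irreducible p) (c : ℂ) : p ≠ C (C c) := by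
  rintro rfl
  rcases eq_or_ne c 0 with rfl | hc
  · exact hp.ne_zero (by simp)
  · exact hp.not_isUnit (IsUnit.map C (IsUnit.map C (isUnit_iff_ne_zero.2 hc)))

theorem exists_irreducibleCurve_dvd {f g : ℂ[X]} {F : ℂ[X][Y]}
    (hF : IsInvariantCurve Y (rhs f g) F) : ∃ p, IsIrreducibleCurve f g p ∧ p ∣ F := by
  obtain ⟨hc, l, hl⟩ := hF
  have hF0 : F ≠ 0 := by simpa using hc 0
  have hu : ¬ IsUnit F := by
    intro hu
    obtain ⟨p, hp, rfl⟩ := Polynomial.isUnit_iff.1 hu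
    obtain ⟨c, -, rfl⟩ := Polynomial.isUnit_iff.1 hp
    exact hc c rfl
  obtain ⟨p, hp, hpF⟩ := WfDvdMonoid.exists_irreducible_factor hu hF0
  have h : F ∣ vectorField Y (rhs f g) F := ⟨l, by rw [hl, mul_comm]⟩
  obtain ⟨l', hl'⟩ := dvd_vectorField_of_irreducible_dvd hF0 h hp hpF
  exact ⟨p, ⟨hp, ne_C_C_of_irreducible hp, l', by rw [hl', mul_comm]⟩, hpF⟩

/-! ### A system with few invariant curves has no rational first integral -/

theorem eq_C_C_of_sub_eq_C_C {A B : ℂ[X][Y]} {c d s t : ℂ} (hcd : c ≠ d)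
    (hc : A - C (C c) * B = C (C s)) (hd : A - C (C d) * B = C (C t)) :
    ∃ a b : ℂ, A = C (C a) ∧ B = C (C b) := by
  have h : C (C (d - c)) * B = C (C (s - t)) := by
    simp only [map_sub, ← hc, ← hd]; ring
  have hB : B = C (C ((d - c)⁻¹ * (s - t))) := by
    calc B = C (C (d - c)⁻¹) * (C (C (d - c)) * B) := by
          rw [← mul_assoc, ← map_mul, ← map_mul, inv_mul_cancel₀ (sub_ne_zero.2 hcd.symm)]; simp
      _ = _ := by rw [h, ← map_mul, ← map_mul]
  refine ⟨s + c * ((d - c)⁻¹ * (s - t)), _, ?_, hB⟩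
  rw [sub_eq_iff_eq_add.1 hc, hB]; simp only [map_add, map_mul]

theorem encard_irreducibleCurves_eq_top {f g : ℂ[X]}
    (h : HasRationalFirstIntegral Y (rhs f g)) : (irreducibleCurves f g).encard = ⊤ := by
  obtain ⟨A, B, hB, hAB, h⟩ := h
  obtain ⟨A, B, D, hrel, rfl, rfl⟩ := UniqueFactorizationMonoid.exists_reduced_factors' A B hB
  have hD : D ≠ 0 := left_ne_zero_of_mul hB
  have hB0 : B ≠ 0 := right_ne_zero_of_mul hB
  replace hAB : ∀ c : ℂ, A ≠ C (C c) * B := fun c hc => hAB c (by rw [hc]; ring)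
  replace h : B * vectorField Y (rhs f g) A = A * vectorField Y (rhs f g) B := by
    simp only [vectorField_mul] at h
    have : D ^ 2 * (B * vectorField Y (rhs f g) A - A * vectorField Y (rhs f g) B) = 0 := by
      linear_combination h
    exact sub_eq_zero.1 ((mul_eq_zero.1 this).resolve_left (pow_ne_zero 2 hD))
  -- Since A and B are coprime, B · 𝒳A = A · 𝒳B forces B ∣ 𝒳B, and the quotient is then a cofactor
  -- of A as well.
  obtain ⟨l, hl⟩ : B ∣ vectorField Y (rhs f g) B :=
    hrel.symm.dvd_of_dvd_mul_left ⟨_, h.symm⟩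
  have hlA : vectorField Y (rhs f g) A = l * A := by
    apply mul_left_cancel₀ hB0; rw [h, hl]; ring
  have hinv : ∀ c : ℂ, vectorField Y (rhs f g) (A - C (C c) * B) = l * (A - C (C c) * B) := by
    intro c; rw [vectorField_sub, vectorField_mul, vectorField_C_C, hlA, hl]; ring
  set S : Set ℂ := {c | ∀ s : ℂ, A - C (C c) * B ≠ C (C s)}
  -- Two constant members of the pencil would make A and B constant, and so A / B too.
  have hS : Sᶜ.Subsingleton := by
    intro c hc d hd
    by_contra hcd
    simp only [S, Set.mem_compl_iff, Set.mem_ofPred_eq, not_forall, not_not] at hc hd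
    obtain ⟨s, hs⟩ := hc
    obtain ⟨t, ht⟩ := hd
    obtain ⟨a, b, rfl, rfl⟩ := eq_C_C_of_sub_eq_C_C hcd hs ht
    have hb : b ≠ 0 := by rintro rfl; simp at hB0
    exact hAB (a / b) (by rw [← map_mul, ← map_mul, div_mul_cancel₀ a hb])
  have hSinf : S.Infinite := by
    have := hS.finite.infinite_compl
    rwa [compl_compl] at this
  have key : ∀ c : S, ∃ p, IsIrreducibleCurve f g p ∧ p ∣ A - C (C c.1) * B := fun c =>
    exists_irreducibleCurve_dvd ⟨c.2, l, hinv c.1⟩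
  choose p hp hpd using key
  -- A common factor of two members of the pencil divides both A and B, which are coprime.
  have hinj : Function.Injective fun c : S => Associates.mk (p c) := by
    intro c d hcd
    by_contra hne
    have hne' : c.1 ≠ d.1 := fun h => hne (Subtype.ext h)
    have hd : p c ∣ A - C (C d.1) * B :=
      (Associates.mk_eq_mk_iff_associated.1 hcd).dvd.trans (hpd d)
    have hdB : p c ∣ C (C (d.1 - c.1)) * B := by
      have := dvd_sub (hpd c) hd
      convert this using 1; simp only [map_sub]; ring
    have hu : IsUnit (C (C (d.1 - c.1)) : ℂ[X][Y]) :=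
      IsUnit.map C (IsUnit.map C (isUnit_iff_ne_zero.2 (sub_ne_zero.2 hne'.symm)))
    have hB' : p c ∣ B := hu.dvd_mul_left.1 hdB
    have hA' : p c ∣ A := by
      have := dvd_add (hpd c) (hB'.mul_left (C (C c.1)))
      simpa using this
    exact (hp c).1.not_isUnit (hrel hA' hB')
  have : Infinite S := hSinf.to_subtype
  refine Set.encard_eq_top_iff.2 ((Set.infinite_range_of_injective hinj).mono ?_)
  rintro _ ⟨c, rfl⟩
  exact ⟨p c, hp c, rfl⟩

/-! ### The cofactor of an invariant curve -/

theorem coeff_vectorField_rhs (f g : ℂ[X]) (F : ℂ[X][Y]) (j : ℕ) :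
    (vectorField Y (rhs f g) F).coeff (j + 1) = derivative (F.coeff j)
      - f * ((j + 1 : ℂ[X]) * F.coeff (j + 1)) - g * ((j + 2 : ℂ[X]) * F.coeff (j + 2)) := by
  have h : vectorField Y (rhs f g) F =
      Y * partialX F - C f * (Y * derivative F) - C g * derivative F := by
    rw [vectorField, rhs]; ring
  simp only [h, coeff_sub, coeff_C_mul, coeff_X_mul, coeff_partialX, coeff_derivative]
  push_cast; ring

/-- With N the degree of F in y, 𝒳F has degree at most N + 1 in y, and its coefficient there is the
x-derivative of the leading coefficient of F. A cofactor linear in y would make that derivative a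
nonzero multiple of the leading coefficient, contradicting degrees in x. Once the cofactor is free
of y, the derivative must vanish. -/
theorem cofactor_eq_C {f g : ℂ[X]} {F l : ℂ[X][Y]} (hF : F ≠ 0)
    (h : vectorField Y (rhs f g) F = l * F) :
    (∃ l₀, l = C l₀) ∧ ∃ c : ℂ, F.leadingCoeff = C c := by
  set N := F.natDegree
  have hlc : F.leadingCoeff ≠ 0 := leadingCoeff_ne_zero.2 hF
  have htop : (l * F).coeff (N + 1) = derivative F.leadingCoeff := by
    rw [← h, coeff_vectorField_rhs, coeff_eq_zero_of_natDegree_lt (show N < N + 1 by omega),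
      coeff_eq_zero_of_natDegree_lt (show N < N + 2 by omega)]
    simp [N]
  have hhigh : ∀ j, N + 1 < j → (l * F).coeff j = 0 := by
    intro j hj
    obtain ⟨j, rfl⟩ : ∃ i, j = i + 1 := ⟨j - 1, by omega⟩
    rw [← h, coeff_vectorField_rhs, coeff_eq_zero_of_natDegree_lt (show N < j by omega),
      coeff_eq_zero_of_natDegree_lt (show N < j + 1 by omega),
      coeff_eq_zero_of_natDegree_lt (show N < j + 2 by omega)]
    simp
  have hl : l.natDegree = 0 := by
    by_contra hl
    have hl0 : l ≠ 0 := by rintro rfl; simp at hl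
    have hcoe : (l * F).coeff (l.natDegree + N) = l.leadingCoeff * F.leadingCoeff :=
      coeff_mul_degree_add_degree l F
    have hne : l.leadingCoeff * F.leadingCoeff ≠ 0 :=
      mul_ne_zero (leadingCoeff_ne_zero.2 hl0) hlc
    rcases (show l.natDegree = 1 ∨ 1 < l.natDegree by omega) with h1 | h1
    · rw [h1, add_comm, htop] at hcoe
      have hd : derivative F.leadingCoeff ≠ 0 := hcoe ▸ hne
      have hdeg : F.leadingCoeff.natDegree ≠ 0 := by
        intro h0; rw [eq_C_of_natDegree_eq_zero h0] at hd; simp at hd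
      have := natDegree_derivative_lt hdeg
      rw [hcoe, natDegree_mul (leadingCoeff_ne_zero.2 hl0) hlc] at this
      omega
    · exact hne (hcoe ▸ hhigh _ (by omega))
  refine ⟨⟨_, eq_C_of_natDegree_eq_zero hl⟩, F.leadingCoeff.coeff 0, ?_⟩
  apply eq_C_of_derivative_eq_zero
  rw [← htop, eq_C_of_natDegree_eq_zero hl, coeff_C_mul,
    coeff_eq_zero_of_natDegree_lt (show N < N + 1 by omega), mul_zero]

theorem natDegree_pos_of_isIrreducibleCurve {f g : ℂ[X]} {F : ℂ[X][Y]}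
    (hF : IsIrreducibleCurve f g F) : 0 < F.natDegree := by
  obtain ⟨hirr, hc, l, hl⟩ := hF
  by_contra h0
  obtain ⟨-, c, hlc⟩ := cofactor_eq_C hirr.ne_zero hl
  have := eq_C_of_natDegree_eq_zero (show F.natDegree = 0 by omega)
  rw [leadingCoeff, show F.natDegree = 0 by omega] at hlc
  exact hc c (by rw [this, hlc])

/-! ### Translation along a polynomial -/

theorem partialX_taylor (p : ℂ[X]) (F : ℂ[X][Y]) :
    partialX (taylor p F) =
      taylor p (partialX F) + C (derivative p) * taylor p (derivative F) := by
  induction F using Polynomial.induction_on' with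
  | add F G hF hG => simp only [map_add, partialX_add, hF, hG]; ring
  | monomial n a =>
    induction n with
    | zero => simp
    | succ n ih =>
      have : (monomial (n + 1) a : ℂ[X][Y]) = monomial n a * Y := by simp
      rw [this, taylor_mul, partialX_mul, ih, partialX_mul, derivative_mul]
      simp only [taylor_X, partialX_add, partialX_Y, partialX_C, derivative_X, map_add, taylor_mul,
        mul_zero, add_zero, zero_add, mul_one]
      ring

/-- This is the vector field in the coordinate u = y - p(x). The residuals f + p' and p p' + f p + g
are the quantities that p = q makes small. -/
theorem vectorField_taylor (f g p : ℂ[X]) (F : ℂ[X][Y]) :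
    taylor p (vectorField Y (rhs f g) F) =
      (Y + C p) * partialX (taylor p F)
        - (C (f + derivative p) * Y + C (p * derivative p + f * p + g))
          * derivative (taylor p F) := by
  have hd : derivative (taylor p F) = taylor p (derivative F) := by
    simp [taylor_apply, derivative_comp]
  rw [partialX_taylor, hd]
  simp only [vectorField, rhs, map_add, map_sub, map_neg, taylor_mul, taylor_X, taylor_C,
    map_mul]
  ring

/-! ### The polynomial `q` -/

section q

variable {f g : ℂ[X]}

theorem coeff_q_of_le {l : ℕ} (hl : l ≤ f.natDegree) :
    (q f g).coeff (f.natDegree + 1 - l) = qCoeff f g l := by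
  rw [q, finsetSum_coeff, Finset.sum_eq_single l]
  · simp
  · intro b hb hbl
    rw [coeff_C_mul_X_pow, if_neg]
    rw [Finset.mem_range] at hb
    omega
  · intro h; exact absurd (Finset.mem_range.2 (by omega)) h

theorem natDegree_q_le : (q f g).natDegree ≤ f.natDegree + 1 := by
  refine natDegree_sum_le_of_forall_le _ _ fun l _ => ?_
  exact (natDegree_C_mul_X_pow_le _ _).trans (Nat.sub_le _ _)

theorem qCoeff_zero_ne_zero (hf : f ≠ 0) : qCoeff f g 0 ≠ 0 := by
  rw [qCoeff]
  exact neg_ne_zero.2 (div_ne_zero (leadingCoeff_ne_zero.2 hf)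
    (Nat.cast_add_one_ne_zero _))

theorem natDegree_q (hf : f ≠ 0) : (q f g).natDegree = f.natDegree + 1 := by
  refine le_antisymm natDegree_q_le (le_natDegree_of_ne_zero ?_)
  have := coeff_q_of_le (g := g) (Nat.zero_le f.natDegree)
  rw [Nat.sub_zero] at this
  rw [this]
  exact qCoeff_zero_ne_zero hf

/-- The value q_0 = -f_0 / (m + 1) cancels the leading term of f. Positivity of m is needed because
the zero polynomial has `natDegree` 0. -/
theorem natDegree_f_add_derivative_q_lt (hf : 0 < f.natDegree) :
    (f + derivative (q f g)).natDegree < f.natDegree := by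
  have hle : (f + derivative (q f g)).natDegree ≤ f.natDegree := by
    refine natDegree_add_le_of_degree_le le_rfl ((natDegree_derivative_le _).trans ?_)
    have := natDegree_q_le (f := f) (g := g)
    omega
  refine lt_of_le_of_ne hle fun h => ?_
  have h0 : (f + derivative (q f g)).coeff f.natDegree = 0 := by
    have h1 := coeff_q_of_le (g := g) (Nat.zero_le f.natDegree)
    rw [Nat.sub_zero] at h1
    rw [coeff_add, coeff_derivative, h1, qCoeff, coeff_natDegree]
    have : (f.natDegree : ℂ) + 1 ≠ 0 := Nat.cast_add_one_ne_zero _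
    field_simp
    ring
  rw [← h, coeff_natDegree, leadingCoeff_eq_zero] at h0
  rw [h0, natDegree_zero] at h
  omega

/-- The recursion that defines the coefficients of `q`, cleared of denominators. -/
theorem qCoeff_succ {l : ℕ} (hl : l < f.natDegree) :
    ((f.natDegree : ℂ) - l) * f.leadingCoeff * qCoeff f g (l + 1) =
      ((f.natDegree : ℂ) + 1) *
      ((∑ k ∈ Finset.range (l + 1), qCoeff f g k * f.coeff (f.natDegree - (l + 1 - k))) +
        (∑ k ∈ Finset.range l,
          ((f.natDegree : ℂ) - k) * qCoeff f g (k + 1) * qCoeff f g (l - k)) +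
        g.coeff (2 * f.natDegree - l)) := by
  have hf : f.leadingCoeff ≠ 0 := leadingCoeff_ne_zero.2 (by rintro rfl; simp at hl)
  have hl' : (f.natDegree : ℂ) - l ≠ 0 := sub_ne_zero.2 (by exact_mod_cast hl.ne')
  rw [qCoeff, Finset.sum_range, Finset.sum_range]
  field_simp

theorem coeff_mul_add_sub {A B : ℂ[X]} {a b l : ℕ} (hA : A.natDegree ≤ a)
    (hB : B.natDegree ≤ b) (hla : l ≤ a) (hlb : l ≤ b) :
    (A * B).coeff (a + b - l) =
      ∑ x ∈ Finset.range (l + 1), A.coeff (a - x) * B.coeff (b - (l - x)) := by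
  rw [coeff_mul, ← Finset.sum_subset (s₁ := (Finset.range (l + 1)).image
    fun x => (a - x, b - (l - x)))]
  · rw [Finset.sum_image]
    intro x hx y hy h
    simp only [Finset.coe_range, Set.mem_Iio, Prod.mk.injEq] at hx hy h
    omega
  · intro x hx
    simp only [Finset.mem_image, Finset.mem_range] at hx
    obtain ⟨k, hk, rfl⟩ := hx
    rw [Finset.HasAntidiagonal.mem_antidiagonal]
    dsimp only
    omega
  · rintro ⟨i, j⟩ hx hn
    rw [Finset.HasAntidiagonal.mem_antidiagonal] at hx
    dsimp only at hx ⊢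
    by_cases hi : a < i
    · rw [coeff_eq_zero_of_natDegree_lt (hA.trans_lt hi), zero_mul]
    by_cases hj : b < j
    · rw [coeff_eq_zero_of_natDegree_lt (hB.trans_lt hj), mul_zero]
    exfalso
    refine hn (Finset.mem_image.2 ⟨a - i, Finset.mem_range.2 (by omega), ?_⟩)
    rw [Prod.mk.injEq]
    omega

/-- The coefficients of `q` are such that `q` satisfies `y y_x + f y + g = 0` up to terms of
degree at most `deg f`. -/
theorem natDegree_residual_le (hf : 0 < f.natDegree) (hgf : g.natDegree < 2 * f.natDegree + 1) :
    (q f g * derivative (q f g) + f * q f g + g).natDegree ≤ f.natDegree := by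
  set m := f.natDegree with hm
  have hq : (q f g).natDegree ≤ m + 1 := natDegree_q_le
  have hq' : (derivative (q f g)).natDegree ≤ m :=
    (natDegree_derivative_le _).trans (by omega)
  have hm1 : (m : ℂ) + 1 ≠ 0 := Nat.cast_add_one_ne_zero _
  rw [natDegree_le_iff_coeff_eq_zero]
  intro i hi
  by_cases hi' : 2 * m + 1 < i
  · refine coeff_eq_zero_of_natDegree_lt (lt_of_le_of_lt ?_ hi')
    refine natDegree_add_le_of_degree_le (natDegree_add_le_of_degree_le ?_ ?_) (by omega)
    · exact natDegree_mul_le.trans (by omega)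
    · exact natDegree_mul_le.trans (by omega)
  -- Coefficients are indexed by the distance l from the top degree 2m + 1; the range l ≤ m is where
  -- the recursion for q_l acts.
  obtain ⟨l, hl, rfl⟩ : ∃ l ≤ m, i = m + 1 + m - l := ⟨2 * m + 1 - i, by omega, by omega⟩
  have hcq : ∀ l ≤ m, (q f g).coeff (m + 1 - l) = qCoeff f g l := fun l hl => coeff_q_of_le hl
  have hcq' : ∀ l ≤ m, (derivative (q f g)).coeff (m - l) =
      ((m : ℂ) + 1 - l) * qCoeff f g l := by
    intro l hl
    rw [coeff_derivative, show m - l + 1 = m + 1 - l by omega, hcq l hl, Nat.cast_sub hl]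
    ring
  rw [mul_comm f, coeff_add, coeff_add, coeff_mul_add_sub hq hq' (by omega) hl,
    coeff_mul_add_sub hq hm.ge (by omega) hl]
  have h1 : ∑ x ∈ Finset.range (l + 1),
      (q f g).coeff (m + 1 - x) * (derivative (q f g)).coeff (m - (l - x)) =
      ∑ x ∈ Finset.range (l + 1),
        qCoeff f g x * (((m : ℂ) + 1 - (l - x : ℕ)) * qCoeff f g (l - x)) := by
    refine Finset.sum_congr rfl fun x hx => ?_
    rw [Finset.mem_range] at hx
    rw [hcq x (by omega), hcq' _ (by omega)]
  have h2 : ∑ x ∈ Finset.range (l + 1), (q f g).coeff (m + 1 - x) * f.coeff (m - (l - x)) =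
      ∑ x ∈ Finset.range (l + 1), qCoeff f g x * f.coeff (m - (l - x)) := by
    refine Finset.sum_congr rfl fun x hx => ?_
    rw [Finset.mem_range] at hx
    rw [hcq x (by omega)]
  rw [h1, h2]
  have hq0 : qCoeff f g 0 = -(f.leadingCoeff / ((m : ℂ) + 1)) := by rw [qCoeff]
  cases l with
  | zero =>
    rw [coeff_eq_zero_of_natDegree_lt (p := g) (by omega)]
    simp only [zero_add, Finset.sum_range_one, Nat.sub_zero, Nat.cast_zero, sub_zero, hq0]
    rw [hm, coeff_natDegree, ← hm]
    field_simp
    ring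
  | succ l =>
    rw [show m + 1 + m - (l + 1) = 2 * m - l by omega]
    rw [Finset.sum_range_succ, Finset.sum_range_succ', Finset.sum_range_succ _ (l + 1)]
    -- In q q' the weight from the derivative falls on the second factor, in the recursion on the
    -- first; reversing the inner sum matches them. The two extreme terms, which contain q_0, were
    -- split off before.
    rw [← Finset.sum_range_reflect]
    have h3 : ∑ x ∈ Finset.range l, qCoeff f g (l - 1 - x + 1) *
        (((m : ℂ) + 1 - (l + 1 - (l - 1 - x + 1) : ℕ)) * qCoeff f g (l + 1 - (l - 1 - x + 1))) =
        ∑ k ∈ Finset.range l, ((m : ℂ) - k) * qCoeff f g (k + 1) * qCoeff f g (l - k) := by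
      refine Finset.sum_congr rfl fun x hx => ?_
      rw [Finset.mem_range] at hx
      rw [show l - 1 - x + 1 = l - x by omega, show l + 1 - (l - x) = x + 1 by omega]
      push_cast; ring
    rw [h3]
    have h4 := qCoeff_succ (f := f) (g := g) (l := l) (by omega)
    rw [← hm] at h4
    apply mul_left_cancel₀ hm1
    rw [mul_zero]
    simp only [Nat.sub_self, Nat.sub_zero, Nat.cast_zero, sub_zero]
    rw [show f.coeff m = f.leadingCoeff from rfl, hq0]
    push_cast
    field_simp
    linear_combination -h4

end q

/-! ### Degrees of the coefficients of a translated curve -/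

/-- Polynomials `b j` that satisfy the recursion for the coefficients of an invariant curve, written
in the variable `y - p(x)`, are constant if the cofactor `l` and the residuals `s`, `r` of `p` have
small degree. -/
theorem natDegree_coeff_eq_zero {m N : ℕ} {p s r l : ℂ[X]} {b : ℕ → ℂ[X]} (hm : 0 < m)
    (hp : p.natDegree = m + 1) (hs : s.natDegree < m) (hr : r.natDegree ≤ m)
    (hl : l.natDegree < m) (hN : (b N).natDegree = 0) (hN' : ∀ j, N < j → b j = 0)
    (h0 : p * derivative (b 0) - r * b 1 = l * b 0)
    (hb : ∀ j : ℕ, derivative (b j) + p * derivative (b (j + 1))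
      - (j + 1 : ℂ[X]) * (s * b (j + 1)) - (j + 2 : ℂ[X]) * (r * b (j + 2)) = l * b (j + 1))
    (j : ℕ) : (b j).natDegree = 0 := by
  have hcast : ∀ (k : ℕ) (u : ℂ[X]), ((k : ℂ[X]) * u).natDegree ≤ u.natDegree := by
    intro k u
    rw [← map_natCast (C : ℂ →+* ℂ[X]) k]
    exact natDegree_C_mul_le _ _
  have hcast1 : ∀ (k : ℕ) (u : ℂ[X]), ((k + 1 : ℂ[X]) * u).natDegree ≤ u.natDegree := by
    intro k u; simpa using hcast (k + 1) u
  have hcast2 : ∀ (k : ℕ) (u : ℂ[X]), ((k + 2 : ℂ[X]) * u).natDegree ≤ u.natDegree := by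
    intro k u; simpa using hcast (k + 2) u
  have hderiv : ∀ u : ℂ[X], u.natDegree = 0 → derivative u = 0 := fun u hu => by
    rw [eq_C_of_natDegree_eq_zero hu, derivative_C]
  have hanti : ∀ (u : ℂ[X]) (k : ℕ), (derivative u).natDegree < k → u.natDegree ≤ k := by
    intro u k h
    have := natDegree_derivative (p := u)
    omega
  -- a first, crude bound: every coefficient has slope less than `m + 1`
  have hcrude : ∀ k, k ≤ N → (b (N - k)).natDegree ≤ (m + 1) * k - 1 ∧
      (k + 1 ≤ N → (b (N - (k + 1))).natDegree ≤ (m + 1) * (k + 1) - 1) := by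
    -- Two consecutive bounds are carried because the recursion has two steps. At k = 0 the
    -- subtraction truncates and the bound reads 0.
    intro k
    induction k with
    | zero =>
      intro _
      refine ⟨by simp [hN], fun h1 => ?_⟩
      -- The term p b_N' vanishes because b_N is constant. This is what brings the slope strictly
      -- below m + 1, and the induction preserves it.
      have hj := hb (N - 1)
      rw [show N - 1 + 1 = N by omega, show N - 1 + 2 = N + 1 by omega, hN' (N + 1) (by omega),
        hderiv _ hN] at hj
      have hj' : derivative (b (N - 1)) = l * b N + ((N - 1 : ℕ) + 1 : ℂ[X]) * (s * b N) := by
        linear_combination hj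
      have : (derivative (b (N - 1))).natDegree < m := by
        rw [hj']
        refine lt_of_le_of_lt (natDegree_add_le _ _) (max_lt ?_ ?_)
        · exact lt_of_le_of_lt natDegree_mul_le (by omega)
        · exact lt_of_le_of_lt ((hcast1 _ _).trans natDegree_mul_le) (by omega)
      have := hanti _ _ this
      simpa using this
    | succ k ih =>
      intro hk
      obtain ⟨ih1, ih2⟩ := ih (by omega)
      have ih2 := ih2 hk
      refine ⟨ih2, fun hk2 => ?_⟩
      have hj := hb (N - (k + 1 + 1))
      rw [show N - (k + 1 + 1) + 1 = N - (k + 1) by omega,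
        show N - (k + 1 + 1) + 2 = N - k by omega] at hj
      set j := N - (k + 1 + 1)
      set u := b (N - (k + 1))
      set v := b (N - k)
      have hj' : derivative (b j) = l * u + ((j : ℂ[X]) + 1) * (s * u)
          + ((j : ℂ[X]) + 2) * (r * v) - p * derivative u := by linear_combination hj
      have e1 : (m + 1) * (k + 1) = (m + 1) * k + (m + 1) := by ring
      have e2 : (m + 1) * (k + 1 + 1) = (m + 1) * k + (m + 1) + (m + 1) := by ring
      have hlt : (derivative (b j)).natDegree < (m + 1) * (k + 1) + m := by
        rw [hj']
        refine lt_of_le_of_lt (natDegree_sub_le _ _) (max_lt (lt_of_le_of_lt (natDegree_add_le _ _)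
          (max_lt (lt_of_le_of_lt (natDegree_add_le _ _) (max_lt ?_ ?_)) ?_)) ?_)
        · exact lt_of_le_of_lt natDegree_mul_le (by omega)
        · exact lt_of_le_of_lt ((hcast1 _ _).trans natDegree_mul_le) (by omega)
        · exact lt_of_le_of_lt ((hcast2 _ _).trans natDegree_mul_le) (by omega)
        · by_cases hu : u.natDegree = 0
          · rw [hderiv _ hu, mul_zero, natDegree_zero]; omega
          · have := natDegree_derivative_lt hu
            exact lt_of_le_of_lt natDegree_mul_le (by omega)
      have := hanti _ _ hlt
      omega
  -- a coefficient of maximal slope would have to be constant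
  by_contra hj0
  have hjN : j < N := by
    rcases lt_trichotomy j N with h | h | h
    · exact h
    · exact absurd (h ▸ hN) hj0
    · exact absurd (by rw [hN' j h, natDegree_zero]) hj0
  -- The maximal slope d of the Newton polygon, seen from the constant b_N, is attained at k; then
  -- deg b_{N-k} = D = d k.
  obtain ⟨k, hk, hmax⟩ := Finset.exists_max_image (Finset.Icc 1 N)
    (fun k => ((b (N - k)).natDegree : ℚ) / k) ⟨N - j, by rw [Finset.mem_Icc]; omega⟩
  rw [Finset.mem_Icc] at hk
  set d : ℚ := ((b (N - k)).natDegree : ℚ) / k with hd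
  have hk0 : (0 : ℚ) < k := by exact_mod_cast hk.1
  have hdk : ((b (N - k)).natDegree : ℚ) = d * k := by rw [hd]; field_simp
  have hdpos : 0 < d := by
    refine lt_of_lt_of_le ?_ (hmax (N - j) (by rw [Finset.mem_Icc]; omega))
    rw [show N - (N - j) = j by omega]
    exact div_pos (by exact_mod_cast Nat.pos_of_ne_zero hj0)
      (by exact_mod_cast (by omega : 0 < N - j))
  have hbd : ∀ i, i ≤ N → ((b (N - i)).natDegree : ℚ) ≤ d * i := by
    intro i hi
    rcases Nat.eq_zero_or_pos i with rfl | hi0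
    · simp [hN]
    · have := hmax i (by rw [Finset.mem_Icc]; omega)
      rwa [div_le_iff₀ (by exact_mod_cast hi0)] at this
  have hdm : d < m + 1 := by
    rw [hd, div_lt_iff₀ hk0]
    have h1 := (hcrude k hk.2).1
    have h2 : 0 < (m + 1) * k := Nat.mul_pos (by omega) hk.1
    exact_mod_cast (show (b (N - k)).natDegree < (m + 1) * k by omega)
  set D := (b (N - k)).natDegree with hD
  have hDpos : 0 < D := by
    have : (0 : ℚ) < D := by rw [hdk]; positivity
    exact_mod_cast this
  have hlow : (b (N - (k - 1))).natDegree < D := by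
    have := hbd (k - 1) (by omega)
    rw [Nat.cast_sub hk.1] at this
    have h2 : ((b (N - (k - 1))).natDegree : ℚ) < D := by rw [hdk]; push_cast at this; linarith
    exact_mod_cast h2
  have hbig : (p * derivative (b (N - k))).natDegree = m + D := by
    have hne : derivative (b (N - k)) ≠ 0 := by
      intro h
      have := derivative_eq_zero.1 h
      omega
    rw [natDegree_mul (by rintro rfl; simp at hp) hne, hp, natDegree_derivative]
    omega
  -- Every other term of the equation has degree below m + D: the l and s terms because deg l, deg s
  -- < m, the r term because deg b_{N-k+1} < D, and b_{N-k-1}' because d < m + 1. For k = N the last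
  -- one is absent and `h0` is the equation to use.
  have hsmall : (p * derivative (b (N - k))).natDegree < m + D := by
    rcases hk.2.eq_or_lt with rfl | hkN
    · rw [Nat.sub_self] at *
      rw [show k - (k - 1) = 1 by omega] at hlow
      rw [show p * derivative (b 0) = l * b 0 + r * b 1 by linear_combination h0]
      refine lt_of_le_of_lt (natDegree_add_le _ _) (max_lt ?_ ?_)
      · exact lt_of_le_of_lt natDegree_mul_le (by omega)
      · exact lt_of_le_of_lt natDegree_mul_le (by omega)
    · have hj := hb (N - (k + 1))
      rw [show N - (k + 1) + 1 = N - k by omega,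
        show N - (k + 1) + 2 = N - (k - 1) by omega] at hj
      have hup : (derivative (b (N - (k + 1)))).natDegree < m + D := by
        by_cases h0 : (b (N - (k + 1))).natDegree = 0
        · rw [hderiv _ h0, natDegree_zero]; omega
        · have h1 := hbd (k + 1) hkN
          have h2 := natDegree_derivative_lt h0
          have h3 : ((b (N - (k + 1))).natDegree : ℚ) < D + m + 1 := by
            push_cast at h1; linarith
          have h4 : (b (N - (k + 1))).natDegree < D + m + 1 := by exact_mod_cast h3
          omega
      set i := N - (k + 1)
      rw [show p * derivative (b (N - k)) = l * b (N - k) + ((i : ℂ[X]) + 1) * (s * b (N - k))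
        + ((i : ℂ[X]) + 2) * (r * b (N - (k - 1))) - derivative (b i) by linear_combination hj]
      refine lt_of_le_of_lt (natDegree_sub_le _ _) (max_lt (lt_of_le_of_lt (natDegree_add_le _ _)
        (max_lt (lt_of_le_of_lt (natDegree_add_le _ _) (max_lt ?_ ?_)) ?_)) hup)
      · exact lt_of_le_of_lt natDegree_mul_le (by omega)
      · exact lt_of_le_of_lt ((hcast1 _ _).trans natDegree_mul_le) (by omega)
      · exact lt_of_le_of_lt ((hcast2 _ _).trans natDegree_mul_le) (by omega)
  omega

/-- An irreducible invariant curve whose cofactor is a polynomial in `x` of degree less than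
`deg f` is of the form `y - q(x) - z`. -/
theorem associated_lineCurve {f g l : ℂ[X]} {F : ℂ[X][Y]} (hf : 0 < f.natDegree)
    (hgf : g.natDegree < 2 * f.natDegree + 1) (hF : IsIrreducibleCurve f g F)
    (hl : vectorField Y (rhs f g) F = C l * F) (hdeg : l.natDegree < f.natDegree) :
    ∃ z : ℂ, Associated F (lineCurve f g z) := by
  have hf0 : f ≠ 0 := by rintro rfl; simp at hf
  have hF0 := hF.1.ne_zero
  obtain ⟨-, c, hlc⟩ := cofactor_eq_C hF0 hl
  have hN := natDegree_pos_of_isIrreducibleCurve hF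
  set p := q f g with hp
  set B := taylor p F with hB
  have hBN : B.natDegree = F.natDegree := natDegree_taylor F p
  have hBlc : B.leadingCoeff = C c := by rw [← hlc, hB, leadingCoeff_taylor]
  have heq := vectorField_taylor f g p F
  rw [hl, taylor_mul, taylor_C, ← hB] at heq
  set r := p * derivative p + f * p + g with hr
  set s := f + derivative p with hs
  have heq' : C l * B = Y * partialX B + C p * partialX B - C s * (Y * derivative B)
      - C r * derivative B := by rw [heq]; ring
  have hconst : ∀ j, (B.coeff j).natDegree = 0 := by
    refine natDegree_coeff_eq_zero (m := f.natDegree) (N := B.natDegree) (p := p) (s := s) (r := r)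
      (l := l) hf (natDegree_q hf0) (natDegree_f_add_derivative_q_lt hf)
      (natDegree_residual_le hf hgf) hdeg ?_ (fun j hj => coeff_eq_zero_of_natDegree_lt hj) ?_ ?_
    · rw [coeff_natDegree, hBlc, natDegree_C]
    · have := congrArg (fun H => H.coeff 0) heq'
      simp only [coeff_add, coeff_sub, coeff_C_mul, coeff_X_mul_zero, coeff_partialX,
        coeff_derivative] at this
      rw [this]; push_cast; ring
    · intro j
      have := congrArg (fun H => H.coeff (j + 1)) heq'
      simp only [coeff_add, coeff_sub, coeff_C_mul, coeff_X_mul, coeff_partialX,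
        coeff_derivative] at this
      rw [this]; push_cast; ring
  obtain ⟨B₀, hB₀⟩ : ∃ B₀ : ℂ[X], B = B₀.map C := by
    have : B ∈ Polynomial.lifts (C : ℂ →+* ℂ[X]) :=
      (lifts_iff_coeff_lifts B).2 fun j => ⟨_, (eq_C_of_natDegree_eq_zero (hconst j)).symm⟩
    obtain ⟨B₀, h⟩ := (mem_lifts B).1 this
    exact ⟨B₀, h.symm⟩
  have hdeg₀ : B₀.degree ≠ 0 := by
    have h1 : B₀.natDegree = F.natDegree := by
      rw [← hBN, hB₀, natDegree_map_eq_of_injective C_injective]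
    intro h
    rw [natDegree_eq_of_degree_eq_some h] at h1
    exact hN.ne h1
  -- A complex root z gives the factor u - z of F(x, u + q), and translating back gives the factor y
  -- - q - z of F.
  obtain ⟨z, hz⟩ := IsAlgClosed.exists_root B₀ hdeg₀
  refine ⟨z, ?_⟩
  have hdvd : lineCurve f g z ∣ F := by
    have h1 : (Y - C (C z) : ℂ[X][Y]) ∣ B := by
      have := (mapRingHom (C : ℂ →+* ℂ[X])).map_dvd (dvd_iff_isRoot.2 hz)
      simpa [hB₀] using this
    have h2 := (taylorAlgHom (-p)).toRingHom.map_dvd h1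
    have h3 : taylor (-p) B = F := by rw [hB, taylor_taylor]; simp
    have h4 : taylor (-p) (Y - C (C z) : ℂ[X][Y]) = lineCurve f g z := by
      simp only [lineCurve, map_sub, taylor_X, taylor_C, map_neg]; ring
    change taylor (-p) _ ∣ taylor (-p) B at h2
    rwa [h3, h4] at h2
  refine (hF.1.dvd_iff.1 hdvd).resolve_left fun hu => ?_
  have h1 : lineCurve f g z = Y - C (q f g + C z) := by rw [lineCurve, map_add]; ring
  rw [h1] at hu
  exact not_isUnit_X_sub_C _ hu

/-- Substituting y = q + z kills the cofactor term. -/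
theorem eq_zero_of_isInvariantCurve_lineCurve {f g : ℂ[X]} {z : ℂ}
    (h : IsInvariantCurve Y (rhs f g) (lineCurve f g z)) :
    (q f g + C z) * derivative (q f g) + f * (q f g + C z) + g = 0 := by
  obtain ⟨-, l, hl⟩ := h
  have h1 : lineCurve f g z = Y - C (q f g + C z) := by rw [lineCurve, map_add]; ring
  have h2 := congrArg (eval (q f g + C z)) hl
  rw [h1] at h2
  simp only [vectorField, rhs, partialX_sub, partialX_Y, partialX_C, derivative_sub, derivative_X,
    derivative_C, derivative_add, eval_mul, eval_add, eval_sub, eval_neg, eval_X, eval_C,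
    sub_self, mul_zero, add_zero, sub_zero, zero_sub, mul_one] at h2
  linear_combination -h2

/-- Subtracting the two equations leaves (z - z')(q' + f) = 0, and q' = -f would reduce either
equation to g = 0. -/
theorem eq_of_isInvariantCurve_lineCurve {f g : ℂ[X]} (hg : g ≠ 0) {z z' : ℂ}
    (h : IsInvariantCurve Y (rhs f g) (lineCurve f g z))
    (h' : IsInvariantCurve Y (rhs f g) (lineCurve f g z')) : z = z' := by
  replace h := eq_zero_of_isInvariantCurve_lineCurve h
  replace h' := eq_zero_of_isInvariantCurve_lineCurve h'
  have h1 : C (z - z') * (derivative (q f g) + f) = 0 := by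
    rw [map_sub]; linear_combination h - h'
  rcases mul_eq_zero.1 h1 with h2 | h2
  · exact sub_eq_zero.1 (C_eq_zero.1 h2)
  · exact absurd (by linear_combination h - (q f g + C z) * h2) hg

theorem IsInvariantCurve.of_associated {P Q F G : ℂ[X][Y]} (hF : IsInvariantCurve P Q F)
    (h : Associated F G) : IsInvariantCurve P Q G := by
  obtain ⟨u, rfl⟩ := h
  obtain ⟨c, hc, hu⟩ : ∃ c : ℂ, c ≠ 0 ∧ (u : ℂ[X][Y]) = C (C c) := by
    obtain ⟨p, hp, hpu⟩ := Polynomial.isUnit_iff.1 u.isUnit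
    obtain ⟨c, hc, rfl⟩ := Polynomial.isUnit_iff.1 hp
    exact ⟨c, hc.ne_zero, hpu.symm⟩
  obtain ⟨hF, l, hl⟩ := hF
  rw [hu]
  refine ⟨fun d hd => hF (d / c) ?_, l, ?_⟩
  · calc F = F * C (C c) * C (C c⁻¹) := by
          rw [mul_assoc, ← map_mul, ← map_mul, mul_inv_cancel₀ hc]; simp
      _ = C (C (d / c)) := by rw [hd, ← map_mul, ← map_mul, div_eq_mul_inv]
  · rw [vectorField_mul, vectorField_C_C, hl]; ring

/-! ### Laurent series near infinity -/

open HahnSeries (single ofPowerSeries)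

theorem single_mul_single_one (a b : ℤ) :
    (single a (1 : ℂ)) * single b (1 : ℂ) = single (a + b) (1 : ℂ) := by
  rw [HahnSeries.single_mul_single, mul_one]

theorem coeff_derivX (y : LaurentSeries ℂ) (k : ℤ) :
    (derivX y).coeff k = -(((k : ℂ) - 1) * y.coeff (k - 1)) := by
  rw [derivX, HahnSeries.coeff_neg, HahnSeries.coeff_single_mul, one_mul,
    LaurentSeries.derivative_apply, LaurentSeries.hasseDeriv_coeff]
  simp only [Nat.cast_one, Ring.choose_one_right]
  rw [show k - 2 + 1 = k - 1 by ring, zsmul_eq_mul]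
  push_cast; ring

theorem derivX_add (y z : LaurentSeries ℂ) : derivX (y + z) = derivX y + derivX z := by
  simp only [derivX, map_add]; ring

theorem coeff_X_mul_derivative (u : PowerSeries ℂ) (i : ℕ) :
    PowerSeries.coeff i (PowerSeries.X * PowerSeries.derivative ℂ u) =
      i * PowerSeries.coeff i u := by
  cases i with
  | zero => simp
  | succ i => rw [PowerSeries.coeff_succ_X_mul, PowerSeries.coeff_derivative]; push_cast; ring

theorem exists_eq_single_mul {y : LaurentSeries ℂ} {a : ℤ} (h : ∀ k < a, y.coeff k = 0) :
    ∃ u : PowerSeries ℂ, y = single a 1 * ofPowerSeries ℤ ℂ u := by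
  refine ⟨PowerSeries.mk fun i => y.coeff (a + i), ?_⟩
  ext k
  rw [HahnSeries.coeff_single_mul, one_mul, PowerSeries.coeff_coe]
  split_ifs with hk
  · exact h k (by omega)
  · rw [PowerSeries.coeff_mk]; congr 1; omega

theorem derivX_single_mul (a : ℤ) (u : PowerSeries ℂ) :
    derivX (single a 1 * ofPowerSeries ℤ ℂ u) =
      -(single (a + 1) 1 * ofPowerSeries ℤ ℂ
        (PowerSeries.C (a : ℂ) * u + PowerSeries.X * PowerSeries.derivative ℂ u)) := by
  ext k
  rw [coeff_derivX, HahnSeries.coeff_neg, HahnSeries.coeff_single_mul, HahnSeries.coeff_single_mul,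
    one_mul, one_mul, PowerSeries.coeff_coe, PowerSeries.coeff_coe,
    show k - (a + 1) = k - 1 - a by ring]
  split_ifs with hk
  · simp
  · rw [map_add, PowerSeries.coeff_C_mul, coeff_X_mul_derivative, ← add_mul]
    congr 2
    have : ((k - 1 - a).natAbs : ℤ) = k - 1 - a := by omega
    rw [← Int.cast_natCast (R := ℂ), this]; push_cast; ring

/-- Leibniz is inherited from power series after a power of t is split off each factor. -/
theorem derivX_mul (y z : LaurentSeries ℂ) : derivX (y * z) = derivX y * z + y * derivX z := by
  obtain ⟨u, hu⟩ := exists_eq_single_mul (y := y) (a := y.order)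
    fun k hk => HahnSeries.coeff_eq_zero_of_lt_order hk
  obtain ⟨v, hv⟩ := exists_eq_single_mul (y := z) (a := z.order)
    fun k hk => HahnSeries.coeff_eq_zero_of_lt_order hk
  generalize y.order = a at hu
  generalize z.order = b at hv
  subst hu hv
  have h : single a (1 : ℂ) * ofPowerSeries ℤ ℂ u * (single b 1 * ofPowerSeries ℤ ℂ v) =
      single (a + b) 1 * ofPowerSeries ℤ ℂ (u * v) := by
    rw [← single_mul_single_one, map_mul]; ring
  rw [h, derivX_single_mul, derivX_single_mul, derivX_single_mul]
  simp only [← single_mul_single_one, map_add, map_mul, Derivation.leibniz, smul_eq_mul,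
    Int.cast_add]
  ring

theorem atInfinity_C (c : ℂ) : atInfinity (C c) = single 0 c := by
  have h : atInfinity (C c) = algebraMap ℂ (LaurentSeries ℂ) c := aeval_C _ c
  rw [h, HahnSeries.algebraMap_apply', PowerSeries.algebraMap_apply, HahnSeries.ofPowerSeries_C,
    HahnSeries.C_apply, Algebra.algebraMap_self_apply]

theorem atInfinity_X : atInfinity X = single (-1) 1 := by
  simp [atInfinity]

theorem atInfinity_monomial (i : ℕ) (c : ℂ) :
    atInfinity (monomial i c) = single (-(i : ℤ)) c := by
  rw [← C_mul_X_pow_eq_monomial, map_mul, map_pow, atInfinity_C, atInfinity_X,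
    HahnSeries.single_pow, HahnSeries.single_mul_single]
  simp

theorem coeff_atInfinity (p : ℂ[X]) (k : ℤ) :
    (atInfinity p).coeff k = if k ≤ 0 then p.coeff k.natAbs else 0 := by
  induction p using Polynomial.induction_on' with
  | add p r hp hr => rw [map_add, HahnSeries.coeff_add, hp, hr, coeff_add]; split_ifs <;> simp
  | monomial i c =>
    rw [atInfinity_monomial, coeff_monomial, HahnSeries.coeff_single]
    split_ifs <;> first | rfl | omega

theorem atInfinity_injective : Function.Injective atInfinity := by
  intro p r h
  ext i
  have := congrArg (fun y : LaurentSeries ℂ => y.coeff (-(i : ℤ))) h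
  simpa [coeff_atInfinity] using this

theorem order_atInfinity {p : ℂ[X]} (hp : p ≠ 0) :
    (atInfinity p).order = -(p.natDegree : ℤ) := by
  have h0 : atInfinity p ≠ 0 := (map_ne_zero_iff _ atInfinity_injective).2 hp
  apply le_antisymm
  · refine HahnSeries.order_le_of_coeff_ne_zero ?_
    simpa [coeff_atInfinity] using hp
  · rw [HahnSeries.le_order_iff_forall h0]
    intro k hk
    rw [coeff_atInfinity, if_pos (by omega), coeff_eq_zero_of_natDegree_lt (by omega)]

theorem derivX_atInfinity (p : ℂ[X]) : derivX (atInfinity p) = atInfinity (derivative p) := by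
  ext k
  rw [coeff_derivX, coeff_atInfinity, coeff_atInfinity]
  by_cases hk : k ≤ 0
  · rw [if_pos (by omega), if_pos hk, coeff_derivative,
      show (k - 1).natAbs = k.natAbs + 1 by omega]
    have : (k.natAbs : ℤ) = -k := by omega
    rw [← Int.cast_natCast (R := ℂ), this]; push_cast; ring
  · rcases eq_or_ne k 1 with rfl | hk1
    · simp
    · rw [if_neg (by omega), if_neg hk]; simp

/-- The chain rule along a Laurent series. -/
theorem derivX_eval₂ (F : ℂ[X][Y]) (y : LaurentSeries ℂ) :
    derivX (F.eval₂ atInfinity y) =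
      (partialX F).eval₂ atInfinity y + (derivative F).eval₂ atInfinity y * derivX y := by
  induction F using Polynomial.induction_on' with
  | add F G hF hG => simp only [eval₂_add, derivX_add, partialX_add, derivative_add, hF, hG]; ring
  | monomial n a =>
    induction n with
    | zero => simp [derivX_atInfinity]
    | succ n ih =>
      have : (monomial (n + 1) a : ℂ[X][Y]) = monomial n a * Y := by simp
      rw [this, eval₂_mul, derivX_mul, ih, partialX_mul, derivative_mul]
      simp only [partialX_Y, derivative_X, mul_zero, mul_one, add_zero, eval₂_add, eval₂_mul,
        eval₂_X]
      ring

theorem eval₂_vectorField {f g : ℂ[X]} {y : LaurentSeries ℂ}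
    (hy : y * derivX y + atInfinity f * y + atInfinity g = 0) (F : ℂ[X][Y]) :
    (vectorField Y (rhs f g) F).eval₂ atInfinity y = y * derivX (F.eval₂ atInfinity y) := by
  rw [derivX_eval₂]
  simp only [vectorField, rhs, eval₂_add, eval₂_mul, eval₂_sub, eval₂_neg, eval₂_X, eval₂_C]
  linear_combination -(derivative F).eval₂ atInfinity y * hy

theorem order_add_one_le_order_derivX {y : LaurentSeries ℂ} (hy : derivX y ≠ 0) :
    y.order + 1 ≤ (derivX y).order := by
  rw [HahnSeries.le_order_iff_forall hy]
  intro k hk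
  rw [coeff_derivX, HahnSeries.coeff_eq_zero_of_lt_order (by omega), mul_zero, neg_zero]

/-- A nonzero cofactor of a curve that does not capture the series `y` has degree in `x` less than
the degree of `y`. -/
theorem natDegree_cofactor_le {f g l : ℂ[X]} {F : ℂ[X][Y]} {y : LaurentSeries ℂ}
    (hy : y * derivX y + atInfinity f * y + atInfinity g = 0)
    (hl : vectorField Y (rhs f g) F = C l * F) (hF : ¬ Captures F y) :
    l = 0 ∨ y.order + 1 ≤ -(l.natDegree : ℤ) := by
  refine or_iff_not_imp_left.2 fun hl0 => ?_
  have h := eval₂_vectorField hy F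
  rw [hl, eval₂_mul, eval₂_C] at h
  have hl' : atInfinity l ≠ 0 := (map_ne_zero_iff _ atInfinity_injective).2 hl0
  have hne : atInfinity l * F.eval₂ atInfinity y ≠ 0 := mul_ne_zero hl' hF
  have hd : derivX (F.eval₂ atInfinity y) ≠ 0 := by
    intro h0; rw [h, h0, mul_zero] at hne; exact hne rfl
  have hy0 : y ≠ 0 := by
    intro h0; rw [h, h0, zero_mul] at hne; exact hne rfl
  have ho := congrArg HahnSeries.order h
  -- Orders in t = 1/x: with E the value of F on y, -deg l + ord E = ord y + ord E_x, and ord E_x ≥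
  -- ord E + 1.
  rw [HahnSeries.order_mul hl' hF, HahnSeries.order_mul hy0 hd, order_atInfinity hl0] at ho
  have := order_add_one_le_order_derivX hd
  omega

/-! ### The series of type (II) -/

/-- A contracting map on power series has exactly one fixed point. -/
theorem existsUnique_fixedPoint {R : Type*} [CommRing R] (Φ : PowerSeries R → PowerSeries R)
    (hΦ : ∀ (k : ℕ) (u v : PowerSeries R), PowerSeries.X ^ k ∣ u - v →
      PowerSeries.X ^ (k + 1) ∣ Φ u - Φ v) : ∃! u, Φ u = u := by
  have hiter : ∀ k, PowerSeries.X ^ k ∣ Φ^[k + 1] 0 - Φ^[k] 0 := by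
    intro k
    induction k with
    | zero => simp
    | succ k ih =>
      rw [Function.iterate_succ_apply' Φ (k + 1), Function.iterate_succ_apply' Φ k]
      rw [Function.iterate_succ_apply' Φ k] at ih
      exact hΦ _ _ _ ih
  have hiter' : ∀ k j, k ≤ j → PowerSeries.X ^ k ∣ Φ^[j] 0 - Φ^[k] 0 := by
    intro k j hkj
    induction j, hkj using Nat.le_induction with
    | base => simp
    | succ j hkj ih =>
      have := dvd_add ((pow_dvd_pow _ hkj).trans (hiter j)) ih
      simpa using this
  -- The k-th coefficient no longer changes from the iterate k + 1 on.
  set u : PowerSeries R := PowerSeries.mk fun k => PowerSeries.coeff k (Φ^[k + 1] 0) with hu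
  have huk : ∀ k, PowerSeries.X ^ k ∣ u - Φ^[k] 0 := by
    intro k
    rw [PowerSeries.X_pow_dvd_iff]
    intro i hi
    have := PowerSeries.X_pow_dvd_iff.1 (hiter' (i + 1) k hi) i (by omega)
    rw [map_sub, sub_eq_zero] at this ⊢
    rw [hu, PowerSeries.coeff_mk, this]
  have hzero : ∀ w : PowerSeries R, (∀ k, PowerSeries.X ^ k ∣ w) → w = 0 := by
    intro w hw
    ext i
    simpa using PowerSeries.X_pow_dvd_iff.1 (hw (i + 1)) i (by omega)
  refine ⟨u, sub_eq_zero.1 (hzero _ fun k => ?_), fun v hv => sub_eq_zero.1 (hzero _ fun k => ?_)⟩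
  · have h1 := hΦ k _ _ (huk k)
    rw [← Function.iterate_succ_apply' Φ k] at h1
    have := (pow_dvd_pow PowerSeries.X (Nat.le_succ k)).trans
      (dvd_sub h1 (huk (k + 1)))
    simpa using this
  · induction k with
    | zero => simp
    | succ k ih =>
      have h1 : PowerSeries.X ^ k ∣ u - Φ^[k] 0 := huk k
      have h2 := hΦ k v (Φ^[k] 0) (by simpa using dvd_add ih h1)
      rw [hv, ← Function.iterate_succ_apply' Φ k] at h2
      simpa using dvd_sub h2 (huk (k + 1))

theorem exists_atInfinity_eq (p : ℂ[X]) : ∃ u : PowerSeries ℂ,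
    atInfinity p = single (-(p.natDegree : ℤ)) 1 * ofPowerSeries ℤ ℂ u ∧
    PowerSeries.constantCoeff u = p.leadingCoeff := by
  obtain ⟨u, hu⟩ := exists_eq_single_mul (y := atInfinity p) (a := -(p.natDegree : ℤ)) (by
    intro k hk
    rw [coeff_atInfinity, if_pos (by omega), coeff_eq_zero_of_natDegree_lt (by omega)])
  refine ⟨u, hu, ?_⟩
  have := congrArg (fun y : LaurentSeries ℂ => y.coeff (-(p.natDegree : ℤ))) hu
  simp only [coeff_atInfinity, HahnSeries.coeff_single_mul, PowerSeries.coeff_coe] at this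
  simpa using this.symm

/-- With y = t^(m-n) w, f = t^(-m) u and g = t^(-n) v, the equation becomes u w + v = t^(2m+1-n)
N(w). Since u is invertible and n < 2m + 1, w is the fixed point of a t-adic contraction; its
constant term is -g_0 / f_0. -/
theorem existsUnique_isTypeTwoSeries {f g : ℂ[X]} (hf : f ≠ 0)
    (hgf : g.natDegree < 2 * f.natDegree + 1) : ∃! y, IsTypeTwoSeries f g y := by
  obtain ⟨u, hu, hu0⟩ := exists_atInfinity_eq f
  obtain ⟨v, hv, hv0⟩ := exists_atInfinity_eq g
  have hlc : f.leadingCoeff ≠ 0 := leadingCoeff_ne_zero.2 hf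
  have hu' : u * u⁻¹ = 1 := PowerSeries.mul_inv_cancel u (by rwa [hu0])
  obtain ⟨e, he⟩ : ∃ e, g.natDegree + (e + 1) = 2 * f.natDegree + 1 :=
    ⟨2 * f.natDegree - g.natDegree, by omega⟩
  set a : ℤ := (f.natDegree : ℤ) - g.natDegree with ha
  set N : PowerSeries ℂ → PowerSeries ℂ := fun w =>
    w * (PowerSeries.C (a : ℂ) * w + PowerSeries.X * PowerSeries.derivative ℂ w) with hN
  set Φ : PowerSeries ℂ → PowerSeries ℂ := fun w =>
    u⁻¹ * (PowerSeries.X ^ (e + 1) * N w - v) with hΦ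
  have hfix : ∀ w, Φ w = w ↔ u * w + v - PowerSeries.X ^ (e + 1) * N w = 0 := by
    intro w
    constructor
    · intro h
      have h1 : u * Φ w = u * w := by rw [h]
      simp only [hΦ] at h1
      linear_combination -h1 + (PowerSeries.X ^ (e + 1) * N w - v) * hu'
    · intro h
      simp only [hΦ]
      linear_combination -u⁻¹ * h + w * hu'
  have heq : ∀ w, single a 1 * ofPowerSeries ℤ ℂ w * derivX (single a 1 * ofPowerSeries ℤ ℂ w)
      + atInfinity f * (single a 1 * ofPowerSeries ℤ ℂ w) + atInfinity g = 0 ↔ Φ w = w := by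
    intro w
    have h1 : single a 1 * ofPowerSeries ℤ ℂ w * derivX (single a 1 * ofPowerSeries ℤ ℂ w)
      + atInfinity f * (single a 1 * ofPowerSeries ℤ ℂ w) + atInfinity g =
        single (-(g.natDegree : ℤ)) 1 *
          ofPowerSeries ℤ ℂ (u * w + v - PowerSeries.X ^ (e + 1) * N w) := by
      rw [hu, hv, derivX_single_mul]
      simp only [hN, map_add, map_sub, map_mul, HahnSeries.ofPowerSeries_X_pow]
      have e1 : single a (1 : ℂ) * single (a + 1) (1 : ℂ) =
          single (-(g.natDegree : ℤ)) 1 * single ((e + 1 : ℕ) : ℤ) 1 := by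
        rw [single_mul_single_one, single_mul_single_one,
          show a + (a + 1) = -(g.natDegree : ℤ) + ((e + 1 : ℕ) : ℤ) by omega]
      have e2 : single (-(f.natDegree : ℤ)) (1 : ℂ) * single a (1 : ℂ) =
          single (-(g.natDegree : ℤ)) 1 := by
        rw [single_mul_single_one, show -(f.natDegree : ℤ) + a = -(g.natDegree : ℤ) by omega]
      linear_combination ofPowerSeries ℤ ℂ u * ofPowerSeries ℤ ℂ w * e2
        - ofPowerSeries ℤ ℂ w * (ofPowerSeries ℤ ℂ (PowerSeries.C (a : ℂ)) * ofPowerSeries ℤ ℂ w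
          + ofPowerSeries ℤ ℂ PowerSeries.X *
            ofPowerSeries ℤ ℂ (PowerSeries.derivative ℂ w)) * e1
    have h2 : single (-(g.natDegree : ℤ)) (1 : ℂ) ≠ 0 := HahnSeries.single_ne_zero one_ne_zero
    rw [h1, mul_eq_zero, or_iff_right h2, hfix, map_eq_zero_iff _ HahnSeries.ofPowerSeries_injective]
  have hcontr : ∃! w, Φ w = w := by
    refine existsUnique_fixedPoint Φ fun k w w' hk => ?_
    have hd : PowerSeries.X ^ k ∣ PowerSeries.X * PowerSeries.derivative ℂ (w - w') := by
      rw [PowerSeries.X_pow_dvd_iff] at hk ⊢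
      intro i hi
      rw [coeff_X_mul_derivative, hk i hi, mul_zero]
    have hNd : PowerSeries.X ^ k ∣ N w - N w' := by
      have h1 : N w - N w' = (w - w') * (PowerSeries.C (a : ℂ) * (w + w')
          + PowerSeries.X * PowerSeries.derivative ℂ w)
          + w' * (PowerSeries.X * PowerSeries.derivative ℂ (w - w')) := by
        simp only [hN, map_sub]; ring
      rw [h1]
      exact dvd_add (hk.mul_right _) (hd.mul_left _)
    have h2 : Φ w - Φ w' = PowerSeries.X * (N w - N w') * (u⁻¹ * PowerSeries.X ^ e) := by
      simp only [hΦ]; ring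
    rw [h2, pow_succ']
    exact (mul_dvd_mul_left _ hNd).mul_right _
  obtain ⟨w, hw, huniq⟩ := hcontr
  refine ⟨single a 1 * ofPowerSeries ℤ ℂ w, ⟨?_, ?_, (heq w).2 hw⟩, ?_⟩
  · intro k hk
    rw [HahnSeries.coeff_single_mul, PowerSeries.coeff_coe, if_pos (by omega), mul_zero]
  · rw [HahnSeries.coeff_single_mul, PowerSeries.coeff_coe, if_neg (by omega), one_mul, ← ha,
      sub_self, Int.natAbs_zero, PowerSeries.coeff_zero_eq_constantCoeff]
    have h := congrArg PowerSeries.constantCoeff ((hfix w).1 hw)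
    simp only [map_add, map_sub, map_mul, map_pow, PowerSeries.constantCoeff_X, hu0, hv0,
      zero_pow (Nat.succ_ne_zero e), zero_mul, sub_zero, map_zero] at h
    rw [← neg_div, eq_div_iff hlc]
    linear_combination h
  · rintro y ⟨hy1, -, hy3⟩
    obtain ⟨w', rfl⟩ := exists_eq_single_mul hy1
    rw [huniq w' ((heq w').1 hy3)]

theorem IsTypeTwoSeries.order_eq {f g : ℂ[X]} {y : LaurentSeries ℂ} (hf : f ≠ 0) (hg : g ≠ 0)
    (hy : IsTypeTwoSeries f g y) : y.order = (f.natDegree : ℤ) - g.natDegree := by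
  obtain ⟨h1, h2, -⟩ := hy
  have hne : y.coeff ((f.natDegree : ℤ) - g.natDegree) ≠ 0 := by
    rw [h2]
    exact neg_ne_zero.2 (div_ne_zero (leadingCoeff_ne_zero.2 hg) (leadingCoeff_ne_zero.2 hf))
  refine le_antisymm (HahnSeries.order_le_of_coeff_ne_zero hne) ?_
  rwa [HahnSeries.le_order_iff_forall (HahnSeries.ne_zero_of_coeff_ne_zero hne)]

/-! ### Irreducible curves that capture a given series -/

section GaussLemma

variable {R L : Type*} [CommRing R] [IsDomain R] [UniqueFactorizationMonoid R] [Field L]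
  {φ : R →+* L}

/-- Irreducible polynomials with a common root in an extension field are associated. -/
theorem associated_of_eval₂_eq_zero (hφ : Function.Injective φ) {F G : R[X]} {y : L}
    (hF : Irreducible F) (hG : Irreducible G) (hF0 : F.natDegree ≠ 0)
    (hFy : F.eval₂ φ y = 0) (hGy : G.eval₂ φ y = 0) : Associated F G := by
  set ψ : FractionRing R →+* L := IsFractionRing.lift hφ
  have hψ : ψ.comp (algebraMap R (FractionRing R)) = φ :=
    RingHom.ext fun p => IsFractionRing.lift_algebraMap hφ p
  have hFp := hF.isPrimitive hF0
  have hFK := (hFp.irreducible_iff_irreducible_map_fraction_map (K := FractionRing R)).1 hF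
  refine hF.associated_of_dvd hG
    (hFp.dvd_of_fraction_map_dvd_fraction_map (K := FractionRing R) ?_)
  -- Otherwise F and G are coprime over the fraction field, and a Bézout identity evaluated at y
  -- reads 0 = 1.
  by_contra hnd
  obtain ⟨A, B, hAB⟩ := (hFK.coprime_iff_not_dvd).2 hnd
  have := congrArg (eval₂ ψ y) hAB
  rw [eval₂_add, eval₂_mul, eval₂_mul, eval₂_map, eval₂_map, hψ, hFy, hGy, eval₂_one] at this
  simp at this

/-- By Gauss's lemma F stays irreducible over the fraction field, where characteristic 0 makes it
separable; separability survives the passage to L. -/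
theorem separable_map_of_irreducible [CharZero R] (hφ : Function.Injective φ) {F : R[X]}
    (hF : Irreducible F) (hF0 : F.natDegree ≠ 0) : (F.map φ).Separable := by
  set ψ : FractionRing R →+* L := IsFractionRing.lift hφ
  have hψ : ψ.comp (algebraMap R (FractionRing R)) = φ :=
    RingHom.ext fun p => IsFractionRing.lift_algebraMap hφ p
  have hFK := ((hF.isPrimitive hF0).irreducible_iff_irreducible_map_fraction_map
    (K := FractionRing R)).1 hF
  rw [← hψ, ← Polynomial.map_map]
  exact hFK.separable.map

end GaussLemma

theorem captureExponent_eq_one {F : ℂ[X][Y]} {y : LaurentSeries ℂ} (hF : Irreducible F)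
    (hF0 : F.natDegree ≠ 0) (hFy : Captures F y) : captureExponent F y = 1 := by
  have hne : F.map atInfinity ≠ 0 :=
    (Polynomial.map_ne_zero_iff atInfinity_injective).2 hF.ne_zero
  refine le_antisymm (rootMultiplicity_le_one_of_separable
    (separable_map_of_irreducible atInfinity_injective hF hF0) y) ?_
  rw [captureExponent, Nat.one_le_iff_ne_zero, ← Nat.pos_iff_ne_zero, rootMultiplicity_pos hne,
    IsRoot, eval_map]
  exact hFy

theorem associated_lineCurve_of_not_captures {f g : ℂ[X]} {F : ℂ[X][Y]} {y : LaurentSeries ℂ}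
    (hfg : f.natDegree < g.natDegree) (hgf : g.natDegree < 2 * f.natDegree + 1)
    (hy : IsTypeTwoSeries f g y) (hF : IsIrreducibleCurve f g F) (hFy : ¬ Captures F y) :
    ∃ z : ℂ, Associated F (lineCurve f g z) := by
  obtain ⟨l, hl⟩ := hF.2.2
  obtain ⟨⟨l, rfl⟩, -⟩ := cofactor_eq_C hF.1.ne_zero hl
  have hf : 0 < f.natDegree := by omega
  have hf0 : f ≠ 0 := by rintro rfl; simp at hf
  have hg0 : g ≠ 0 := by rintro rfl; simp at hfg
  refine associated_lineCurve hf hgf hF hl ?_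
  rcases natDegree_cofactor_le hy.2.2 hl hFy with rfl | h
  · rwa [natDegree_zero]
  · rw [hy.order_eq hf0 hg0] at h
    omega

end Lienard

/-! ### The theorem: at most one curve that captures y_II and at most one that does not -/

theorem theorem7 (f g : Polynomial ℂ)
    (hfg : f.natDegree < g.natDegree) (hgf : g.natDegree < 2 * f.natDegree + 1) :
    (Lienard.irreducibleCurves f g).encard ≤ 2 ∧
    (∃ y : LaurentSeries ℂ, Lienard.IsTypeTwoSeries f g y ∧
      (∀ y' : LaurentSeries ℂ, Lienard.IsTypeTwoSeries f g y' → y' = y) ∧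
      ∀ F₁ F₂ : Polynomial (Polynomial ℂ),
        Lienard.IsIrreducibleCurve f g F₁ → Lienard.IsIrreducibleCurve f g F₂ →
        ¬ Associated F₁ F₂ →
        ∃ G H : Polynomial (Polynomial ℂ), ((G = F₁ ∧ H = F₂) ∨ (G = F₂ ∧ H = F₁)) ∧
          Lienard.Captures G y ∧ Lienard.captureExponent G y = 1 ∧
          ∃ z₀ : ℂ, Associated H (Lienard.lineCurve f g z₀) ∧
            ∀ z : ℂ, Lienard.IsInvariantCurve Polynomial.X (Lienard.rhs f g)
              (Lienard.lineCurve f g z) → z = z₀) ∧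
    ¬ Lienard.HasRationalFirstIntegral Polynomial.X (Lienard.rhs f g) := by
  open Lienard in
  have hf0 : f ≠ 0 := by rintro rfl; simp at hgf; omega
  have hg0 : g ≠ 0 := by rintro rfl; simp at hfg
  obtain ⟨y, hy, huniq⟩ := existsUnique_isTypeTwoSeries hf0 hgf
  have hline : ∀ F, IsIrreducibleCurve f g F → ¬ Captures F y →
      ∃ z₀ : ℂ, Associated F (lineCurve f g z₀) ∧
        ∀ z : ℂ, IsInvariantCurve Y (rhs f g) (lineCurve f g z) → z = z₀ := by
    intro F hF hFy
    obtain ⟨z₀, hz₀⟩ := associated_lineCurve_of_not_captures hfg hgf hy hF hFy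
    exact ⟨z₀, hz₀, fun z hz => eq_of_isInvariantCurve_lineCurve hg0 hz (hF.2.of_associated hz₀)⟩
  have hnot : ∀ F G, IsIrreducibleCurve f g F → IsIrreducibleCurve f g G →
      ¬ Captures F y → ¬ Captures G y → Associated F G := by
    intro F G hF hG hFy hGy
    obtain ⟨z₀, hz₀, hz⟩ := hline F hF hFy
    obtain ⟨z₁, hz₁, -⟩ := hline G hG hGy
    obtain rfl := hz z₁ (hG.2.of_associated hz₁)
    exact hz₀.trans hz₁.symm
  have hcap : ∀ F G, IsIrreducibleCurve f g F → IsIrreducibleCurve f g G →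
      Captures F y → Captures G y → Associated F G := fun F G hF hG hFy hGy =>
    associated_of_eval₂_eq_zero atInfinity_injective hF.1 hG.1 (natDegree_pos_of_isIrreducibleCurve hF).ne' hFy hGy
  have hcard : (irreducibleCurves f g).encard ≤ 2 := by
    by_contra! h
    obtain ⟨S, hS, hS3⟩ := Set.exists_subset_encard_eq (Order.add_one_le_of_lt h)
    rw [two_add_one_eq_three, Set.encard_eq_three] at hS3
    obtain ⟨c₁, c₂, c₃, h₁₂, h₁₃, h₂₃, rfl⟩ := hS3
    obtain ⟨F₁, hF₁, rfl⟩ := hS (show c₁ ∈ _ by simp)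
    obtain ⟨F₂, hF₂, rfl⟩ := hS (show c₂ ∈ _ by simp)
    obtain ⟨F₃, hF₃, rfl⟩ := hS (show c₃ ∈ _ by simp)
    rw [Ne, Associates.mk_eq_mk_iff_associated] at h₁₂ h₁₃ h₂₃
    -- Pigeonhole: of three curves, two agree on whether they capture y, so they are associated.
    by_cases h₁ : Captures F₁ y <;> by_cases h₂ : Captures F₂ y <;> by_cases h₃ : Captures F₃ y
    · exact h₁₂ (hcap F₁ F₂ hF₁ hF₂ h₁ h₂)
    · exact h₁₂ (hcap F₁ F₂ hF₁ hF₂ h₁ h₂)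
    · exact h₁₃ (hcap F₁ F₃ hF₁ hF₃ h₁ h₃)
    · exact h₂₃ (hnot F₂ F₃ hF₂ hF₃ h₂ h₃)
    · exact h₂₃ (hcap F₂ F₃ hF₂ hF₃ h₂ h₃)
    · exact h₁₃ (hnot F₁ F₃ hF₁ hF₃ h₁ h₃)
    · exact h₁₂ (hnot F₁ F₂ hF₁ hF₂ h₁ h₂)
    · exact h₁₂ (hnot F₁ F₂ hF₁ hF₂ h₁ h₂)
  refine ⟨hcard, ⟨y, hy, huniq, fun F₁ F₂ hF₁ hF₂ hne => ?_⟩, fun h => ?_⟩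
  · by_cases h₁ : Captures F₁ y
    · have h₂ : ¬ Captures F₂ y := fun h₂ => hne (hcap F₁ F₂ hF₁ hF₂ h₁ h₂)
      exact ⟨F₁, F₂, Or.inl ⟨rfl, rfl⟩, h₁, captureExponent_eq_one hF₁.1
        (natDegree_pos_of_isIrreducibleCurve hF₁).ne' h₁, hline F₂ hF₂ h₂⟩
    · have h₂ : Captures F₂ y := by
        by_contra h₂
        exact hne (hnot F₁ F₂ hF₁ hF₂ h₁ h₂)
      exact ⟨F₂, F₁, Or.inr ⟨rfl, rfl⟩, h₂, captureExponent_eq_one hF₂.1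
        (natDegree_pos_of_isIrreducibleCurve hF₂).ne' h₂, hline F₁ hF₁ h₁⟩
  · rw [encard_irreducibleCurves_eq_top h] at hcard
    simp at hcard
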